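/- Let $n\ge 2$, let $\mathbb L^{n+2}$ be $\mathbb R^{n+2}$ with the Lorentzian metric $\langle u,v\rangle=-u_0v_0+\sum_{i=1}^{n+1}u_iv_i$, and let $\Lambda^{n+1}_+=\{v\in\mathbb L^{n+2}:\langle v,v\rangle=0,\ v_0>0\}$ be its future light cone. Let $M^n$ be a connected smooth $n$-manifold (without boundary) and let $\psi:M^n\to\mathbb L^{n+2}$ be a smooth spacelike immersion, i.e. the induced metric on $M^n$ is Riemannian, with $\psi(M^n)\subset\Lambda^{n+1}_+$. Let $\mathrm{II}$ be the second fundamental form of $\psi$, $\mathbf H=\frac1n\,\mathrm{trace}\,\mathrm{II}$ its mean curvature vector field, $\langle \mathrm{II},\mathrm{II}\rangle=\sum_{i,j}\langle \mathrm{II}(e_i,e_j),\mathrm{II}(e_i,e_j)\rangle$ (for orthonormal bases $(e_i)$ of the tangent spaces), and $\nabla^\perp$ the normal connection. A normal field $\nu$ is called parallel if $\nabla^\perp\nu=0$. Then the following assertions are equivalent: 1. $\mathbf H$ is parallel; 2. the function $\langle\mathbf H,\mathbf H\rangle$ is constant on $M^n$; 3. the scalar curvature of the induced metric on $M^n$ is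 constant; 4. the function $\langle \mathrm{II},\mathrm{II}\rangle$ is constant on $M^n$. If, in addition, $\langle\mathbf H,\mathbf H\rangle\neq0$ at every point of $M^n$, then each of these assertions is also equivalent to: 5. the normalized mean curvature vector field $\frac{1}{\sqrt{|\langle\mathbf H,\mathbf H\rangle|}}\,\mathbf H$ is parallel. -/

import Mathlib

open scoped Manifold ContDiff

noncomputable section

namespace LightCone

/-! ### Lorentz-Minkowski spacetime and its future light cone -/

/-- The vector space `ℝ^{n+2}` underlying Lorentz-Minkowski spacetime `𝕃^{n+2}`. (The Euclidean norm
of this type is used only for its topology and for derivatives.) -/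
abbrev Spacetime (n : ℕ) : Type := EuclideanSpace ℝ (Fin (n + 2))

/-- The Lorentzian metric `⟨u, v⟩ = -u₀ v₀ + ∑_{i ≥ 1} u_i v_i`. -/
def lorentz {n : ℕ} (u v : Spacetime n) : ℝ :=
  -(u 0 * v 0) + ∑ i : Fin (n + 1), u i.succ * v i.succ

/-- The future light cone `Λ^{n+1}_+ = {v | ⟨v, v⟩ = 0, v₀ > 0}`. -/
def futureCone (n : ℕ) : Set (Spacetime n) := {v | lorentz v v = 0 ∧ 0 < v 0}

/-! ### Intrinsic geometry of a metric in coordinates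

`G : ℝⁿ → Matrix` is the matrix `(g_{ij})` of a metric in a coordinate domain. -/

section Intrinsic

variable {n : ℕ}

/-- The coordinate vector `e_i` of `ℝⁿ`. -/
abbrev coordVec (i : Fin n) : EuclideanSpace ℝ (Fin n) := EuclideanSpace.single i 1

/-- The partial derivative `∂_i f` at `p` of a function of `n` real variables. -/
def partialDeriv {F : Type*} [NormedAddCommGroup F] [NormedSpace ℝ F] (i : Fin n)
    (f : EuclideanSpace ℝ (Fin n) → F) (p : EuclideanSpace ℝ (Fin n)) : F :=
  fderiv ℝ f p (coordVec i)

/-- The Christoffel symbols of the Levi-Civita connection,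
`Γ^k_{ij} = ½ ∑_l g^{kl} (∂_i g_{jl} + ∂_j g_{il} - ∂_l g_{ij})`. -/
def christoffel (G : EuclideanSpace ℝ (Fin n) → Matrix (Fin n) (Fin n) ℝ) (k i j : Fin n)
    (p : EuclideanSpace ℝ (Fin n)) : ℝ :=
  (1 / 2) * ∑ l, (G p)⁻¹ k l *
    (partialDeriv i (fun q => G q j l) p + partialDeriv j (fun q => G q i l) p
      - partialDeriv l (fun q => G q i j) p)

/-- The components of the curvature tensor `R(X,Y)Z = ∇_X ∇_Y Z - ∇_Y ∇_X Z - ∇_{[X,Y]} Z`: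
`R(∂_i, ∂_j) ∂_k = ∑_l (riemann G l i j k) ∂_l`. -/
def riemann (G : EuclideanSpace ℝ (Fin n) → Matrix (Fin n) (Fin n) ℝ) (l i j k : Fin n)
    (p : EuclideanSpace ℝ (Fin n)) : ℝ :=
  partialDeriv i (christoffel G l j k) p - partialDeriv j (christoffel G l i k) p
    + ∑ m, (christoffel G m j k p * christoffel G l i m p
      - christoffel G m i k p * christoffel G l j m p)

/-- The Ricci tensor, `Ric(Y, Z) = trace (X ↦ R(X, Y) Z)`. -/
def ricci (G : EuclideanSpace ℝ (Fin n) → Matrix (Fin n) (Fin n) ℝ) (j k : Fin n)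
    (p : EuclideanSpace ℝ (Fin n)) : ℝ :=
  ∑ i, riemann G i i j k p

/-- The scalar curvature, i.e. the metric trace of the Ricci tensor. -/
def scalarCurvatureCoord (G : EuclideanSpace ℝ (Fin n) → Matrix (Fin n) (Fin n) ℝ)
    (p : EuclideanSpace ℝ (Fin n)) : ℝ :=
  ∑ j, ∑ k, (G p)⁻¹ j k * ricci G j k p

end Intrinsic

/-! ### Parametrized spacelike submanifolds

`φ : ℝⁿ → 𝕃^{n+2}` is a local parametrization and `p` a point of its domain. -/

section Parametrized

variable {n : ℕ}

/-- The induced metric `g_{ij} = ⟨∂_i φ, ∂_j φ⟩`. -/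
def gram (φ : EuclideanSpace ℝ (Fin n) → Spacetime n) (p : EuclideanSpace ℝ (Fin n)) :
    Matrix (Fin n) (Fin n) ℝ :=
  Matrix.of fun i j => lorentz (partialDeriv i φ p) (partialDeriv j φ p)

/-- The component of `w` tangent to `φ` at `p`, that is `∑_{ij} g^{ij} ⟨w, ∂_j φ⟩ ∂_i φ`. -/
def tangentPartCoord (φ : EuclideanSpace ℝ (Fin n) → Spacetime n) (p : EuclideanSpace ℝ (Fin n))
    (w : Spacetime n) : Spacetime n :=
  ∑ i, ∑ j, ((gram φ p)⁻¹ i j * lorentz w (partialDeriv j φ p)) • partialDeriv i φ p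

/-- The component of `w` normal to `φ` at `p`. -/
def normalPartCoord (φ : EuclideanSpace ℝ (Fin n) → Spacetime n) (p : EuclideanSpace ℝ (Fin n))
    (w : Spacetime n) : Spacetime n :=
  w - tangentPartCoord φ p w

/-- The second fundamental form `II(∂_i, ∂_j)`: the normal component of the ambient covariant
derivative of the field `∂_j φ` along `∂_i`. -/
def secondFormCoord (φ : EuclideanSpace ℝ (Fin n) → Spacetime n) (i j : Fin n)
    (p : EuclideanSpace ℝ (Fin n)) : Spacetime n :=
  normalPartCoord φ p (partialDeriv i (partialDeriv j φ) p)

/-- The mean curvature vector `(1/n) trace_g II = (1/n) ∑_{ij} g^{ij} II(∂_i, ∂_j)`. -/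
def meanCurvatureCoord (φ : EuclideanSpace ℝ (Fin n) → Spacetime n)
    (p : EuclideanSpace ℝ (Fin n)) : Spacetime n :=
  (1 / (n : ℝ)) • ∑ i, ∑ j, (gram φ p)⁻¹ i j • secondFormCoord φ i j p

/-- The squared length `⟨II, II⟩ = ∑ g^{ik} g^{jl} ⟨II(∂_i, ∂_j), II(∂_k, ∂_l)⟩`; in an orthonormal
basis this is `∑_{ij} ⟨II(e_i, e_j), II(e_i, e_j)⟩`. -/
def secondFormSqCoord (φ : EuclideanSpace ℝ (Fin n) → Spacetime n)
    (p : EuclideanSpace ℝ (Fin n)) : ℝ :=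
  ∑ i, ∑ j, ∑ k, ∑ l, (gram φ p)⁻¹ i k * (gram φ p)⁻¹ j l *
    lorentz (secondFormCoord φ i j p) (secondFormCoord φ k l p)

end Parametrized

/-! ### Immersed spacelike submanifolds of codimension two

Here `M` is an `n`-dimensional manifold without boundary and `ψ : M → 𝕃^{n+2}`. The geometric
quantities at `x` are computed in the preferred chart of `M` at `x`. -/

section Submanifold

variable {n : ℕ} {M : Type*} [TopologicalSpace M] [ChartedSpace (EuclideanSpace ℝ (Fin n)) M]

/-- `ψ` is spacelike: the metric it induces is positive definite (so `ψ` is an immersion). -/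
def IsSpacelike (ψ : M → Spacetime n) : Prop :=
  ∀ (x : M) (v : TangentSpace (𝓡 n) x), v ≠ 0 →
    0 < lorentz (n := n) (mfderiv (𝓡 n) 𝓘(ℝ, Spacetime n) ψ x v)
      (mfderiv (𝓡 n) 𝓘(ℝ, Spacetime n) ψ x v)

/-- The local parametrization of `ψ` given by the preferred chart at `x`. -/
def param (ψ : M → Spacetime n) (x : M) : EuclideanSpace ℝ (Fin n) → Spacetime n :=
  ψ ∘ (extChartAt (𝓡 n) x).symm

/-- The component of `w` normal to `ψ` at `x`. -/
def normalPart (ψ : M → Spacetime n) (x : M) (w : Spacetime n) : Spacetime n :=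
  normalPartCoord (param ψ x) (extChartAt (𝓡 n) x x) w

/-- The mean curvature vector field `𝐇` of `ψ`. -/
def meanCurvature (ψ : M → Spacetime n) (x : M) : Spacetime n :=
  meanCurvatureCoord (param ψ x) (extChartAt (𝓡 n) x x)

/-- The function `⟨II, II⟩` of `ψ`. -/
def secondFormSq (ψ : M → Spacetime n) (x : M) : ℝ :=
  secondFormSqCoord (param ψ x) (extChartAt (𝓡 n) x x)

/-- The scalar curvature of the Riemannian metric induced by `ψ` on `M`. -/
def scalarCurvature (ψ : M → Spacetime n) (x : M) : ℝ :=
  scalarCurvatureCoord (gram (param ψ x)) (extChartAt (𝓡 n) x x)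

/-- The normalized mean curvature vector field `𝐇 / √|⟨𝐇, 𝐇⟩|`. -/
def normalizedMeanCurvature (ψ : M → Spacetime n) (x : M) : Spacetime n :=
  (1 / Real.sqrt |lorentz (meanCurvature ψ x) (meanCurvature ψ x)|) • meanCurvature ψ x

/-- `ν` is a normal vector field along `ψ`. -/
def IsNormalField (ψ ν : M → Spacetime n) : Prop :=
  ∀ (x : M) (v : TangentSpace (𝓡 n) x),
    lorentz (n := n) (ν x) (mfderiv (𝓡 n) 𝓘(ℝ, Spacetime n) ψ x v) = 0

/-- The normal connection: `∇^⊥_v ν` is the normal component of the derivative of `ν` along `v`. -/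
def normalDeriv (ψ ν : M → Spacetime n) (x : M) (v : TangentSpace (𝓡 n) x) : Spacetime n :=
  normalPart ψ x (mfderiv (𝓡 n) 𝓘(ℝ, Spacetime n) ν x v)

/-- `ν` is a parallel normal vector field along `ψ`: a differentiable normal field
with `∇^⊥ ν = 0`. -/
def IsParallel (ψ ν : M → Spacetime n) : Prop :=
  IsNormalField ψ ν ∧ MDifferentiable (𝓡 n) 𝓘(ℝ, Spacetime n) ν ∧
    ∀ (x : M) (v : TangentSpace (𝓡 n) x), normalDeriv ψ ν x v = 0

end Submanifold

/-- A real-valued function is constant. -/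
def IsConst {M : Type*} (f : M → ℝ) : Prop := ∃ c : ℝ, ∀ x, f x = c

end LightCone

end

/-! Along a submanifold of the light cone the position vector is itself a normal field:
differentiating `⟨ψ, ψ⟩ = 0` gives `⟨ψ, dψ⟩ = 0`. It is null, and it is parallel because its
derivative `dψ` is tangent. In codimension two there is a unique second null normal field `η` with
`⟨ψ, η⟩ = -1`, and `ψ, η` span the normal bundle. Differentiating `⟨η, η⟩ = 0` and `⟨ψ, η⟩ = -1`
shows that `η` is parallel too (`isParallel_nullNormal`), so the normal bundle has a global parallel
null frame.

Differentiating `⟨ψ, ∂_j ψ⟩ = 0` once more gives `⟨II(∂_i, ∂_j), ψ⟩ = -g_ij`, hence `II = g ⊗ η + a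
⊗ ψ` for some coefficients `a`. Taking traces, `H = η - (⟨H, H⟩ / 2) ψ` (`meanCurvature_eq`) and
`⟨II, II⟩ = n ⟨H, H⟩` (`secondFormSq_eq`), since only the cross terms of the null frame survive. The
doubly traced Gauss equation reads `scal = n² ⟨H, H⟩ - ⟨II, II⟩`, so `scal = n (n - 1) ⟨H, H⟩`
(`scalarCurvature_eq`).

Assertions 2, 3 and 4 thus concern nonzero multiples of one function, and 1 ↔ 2 holds because `⟨H,
H⟩` is, up to the factor `-1/2`, the only varying coefficient of `H` in the parallel frame. For
assertion 5, the length lost in normalizing is recovered by pairing with the parallel field `ψ`, as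
`⟨H, ψ⟩ = -1`. -/

noncomputable section

namespace LightCone

/-! ### Bilinearity of the Lorentzian form -/

section LorentzForm

variable {n : ℕ}

/-- The Lorentzian metric as a continuous bilinear map. -/
def lorentzL (n : ℕ) : Spacetime n →L[ℝ] Spacetime n →L[ℝ] ℝ :=
  LinearMap.toContinuousLinearMap
    ((LinearMap.toContinuousLinearMap (𝕜 := ℝ) (E := Spacetime n) (F' := ℝ)).toLinearMap ∘ₗ
    LinearMap.mk₂ ℝ (lorentz (n := n))
    (by intro u v w; simp only [lorentz, PiLp.add_apply, add_mul, Finset.sum_add_distrib]; ring)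
    (by
      intro c u v
      simp only [lorentz, PiLp.smul_apply, smul_eq_mul, mul_assoc, ← Finset.mul_sum]; ring)
    (by intro u v w; simp only [lorentz, PiLp.add_apply, mul_add, Finset.sum_add_distrib]; ring)
    (by
      intro c u v
      simp only [lorentz, PiLp.smul_apply, smul_eq_mul, mul_left_comm _ c, ← Finset.mul_sum]; ring))

theorem lorentz_eq (u v : Spacetime n) : lorentz u v = lorentzL n u v := rfl

theorem lorentz_comm (u v : Spacetime n) : lorentz u v = lorentz v u := by
  simp only [lorentz, mul_comm]

@[simp] theorem lorentz_add_left (u v w : Spacetime n) :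
    lorentz (u + v) w = lorentz u w + lorentz v w := by simp [lorentz_eq]
@[simp] theorem lorentz_add_right (u v w : Spacetime n) :
    lorentz w (u + v) = lorentz w u + lorentz w v := by simp [lorentz_eq]
@[simp] theorem lorentz_sub_left (u v w : Spacetime n) :
    lorentz (u - v) w = lorentz u w - lorentz v w := by simp [lorentz_eq]
@[simp] theorem lorentz_smul_left (c : ℝ) (u v : Spacetime n) :
    lorentz (c • u) v = c * lorentz u v := by simp [lorentz_eq]
@[simp] theorem lorentz_smul_right (c : ℝ) (u v : Spacetime n) :
    lorentz u (c • v) = c * lorentz u v := by simp [lorentz_eq]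
@[simp] theorem lorentz_zero_left (u : Spacetime n) : lorentz 0 u = 0 := by simp [lorentz_eq]
theorem lorentz_sum_left {ι : Type*} (s : Finset ι) (f : ι → Spacetime n) (v : Spacetime n) :
    lorentz (∑ i ∈ s, f i) v = ∑ i ∈ s, lorentz (f i) v := by simp [lorentz_eq]
theorem lorentz_sum_right {ι : Type*} (s : Finset ι) (f : ι → Spacetime n) (v : Spacetime n) :
    lorentz v (∑ i ∈ s, f i) = ∑ i ∈ s, lorentz v (f i) := by simp [lorentz_eq]

/-- The unit timelike coordinate vector. -/
def timeVec (n : ℕ) : Spacetime n := EuclideanSpace.single 0 1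

theorem lorentz_timeVec (v : Spacetime n) : lorentz (timeVec n) v = -v 0 := by
  simp [lorentz, timeVec]

end LorentzForm

/-! ### Tangent and normal projections at a point -/

section Pointwise

variable {n : ℕ} {φ : EuclideanSpace ℝ (Fin n) → Spacetime n} {p : EuclideanSpace ℝ (Fin n)}

theorem gram_apply (i j : Fin n) :
    gram φ p i j = lorentz (partialDeriv i φ p) (partialDeriv j φ p) := rfl

theorem gram_transpose : (gram φ p).transpose = gram φ p := by
  ext i j
  exact lorentz_comm _ _

theorem gram_symm (i j : Fin n) : gram φ p i j = gram φ p j i := lorentz_comm _ _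

theorem gram_inv_symm (i j : Fin n) : (gram φ p)⁻¹ i j = (gram φ p)⁻¹ j i := by
  conv_lhs => rw [← gram_transpose, ← Matrix.transpose_nonsing_inv]
  rfl

theorem sum_inv_mul_gram (h : IsUnit (gram φ p).det) (i k : Fin n) :
    ∑ j, (gram φ p)⁻¹ i j * gram φ p j k = if i = k then 1 else 0 := by
  rw [← Matrix.mul_apply, Matrix.nonsing_inv_mul _ h, Matrix.one_apply]

theorem fderiv_eq_sum_partialDeriv {F : Type*} [NormedAddCommGroup F] [NormedSpace ℝ F]
    (f : EuclideanSpace ℝ (Fin n) → F) (p v : EuclideanSpace ℝ (Fin n)) :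
    fderiv ℝ f p v = ∑ i, v i • partialDeriv i f p := by
  conv_lhs => rw [← (EuclideanSpace.basisFun (Fin n) ℝ).sum_repr v]
  simp [partialDeriv, map_sum, coordVec]

theorem tangentPartCoord_add (u v : Spacetime n) :
    tangentPartCoord φ p (u + v) = tangentPartCoord φ p u + tangentPartCoord φ p v := by
  simp only [tangentPartCoord, lorentz_add_left, mul_add, add_smul, Finset.sum_add_distrib]

theorem tangentPartCoord_smul (c : ℝ) (v : Spacetime n) :
    tangentPartCoord φ p (c • v) = c • tangentPartCoord φ p v := by
  simp only [tangentPartCoord, lorentz_smul_left, Finset.smul_sum, smul_smul, mul_left_comm]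

/-- The projection to the normal space as a linear map. -/
def normalPartL (φ : EuclideanSpace ℝ (Fin n) → Spacetime n) (p : EuclideanSpace ℝ (Fin n)) :
    Spacetime n →ₗ[ℝ] Spacetime n where
  toFun := normalPartCoord φ p
  map_add' u v := by simp only [normalPartCoord, tangentPartCoord_add]; abel
  map_smul' c v := by simp only [normalPartCoord, tangentPartCoord_smul, smul_sub, RingHom.id_apply]

theorem normalPartCoord_eq (w : Spacetime n) : normalPartCoord φ p w = normalPartL φ p w := rfl

theorem tangentPartCoord_eq_sum (w : Spacetime n) : tangentPartCoord φ p w =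
    ∑ i, (∑ j, (gram φ p)⁻¹ i j * lorentz w (partialDeriv j φ p)) • partialDeriv i φ p := by
  simp only [tangentPartCoord, Finset.sum_smul]

theorem lorentz_tangentPartCoord_of_normal {w u : Spacetime n}
    (hu : ∀ i, lorentz u (partialDeriv i φ p) = 0) : lorentz (tangentPartCoord φ p w) u = 0 := by
  rw [lorentz_comm]
  simp [tangentPartCoord_eq_sum, lorentz_sum_right, hu]

theorem lorentz_normalPartCoord_of_normal {w u : Spacetime n}
    (hu : ∀ i, lorentz u (partialDeriv i φ p) = 0) :
    lorentz (normalPartCoord φ p w) u = lorentz w u := by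
  simp [normalPartCoord, lorentz_tangentPartCoord_of_normal hu]

theorem lorentz_tangentPartCoord_partialDeriv (h : IsUnit (gram φ p).det) (w : Spacetime n)
    (k : Fin n) : lorentz (tangentPartCoord φ p w) (partialDeriv k φ p) =
      lorentz w (partialDeriv k φ p) := by
  simp only [tangentPartCoord, lorentz_sum_left, lorentz_smul_left, ← gram_apply]
  rw [Finset.sum_comm]
  have (j : Fin n) : ∑ i, (gram φ p)⁻¹ i j * lorentz w (partialDeriv j φ p) * gram φ p i k =
      (if j = k then 1 else 0) * lorentz w (partialDeriv j φ p) := by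
    rw [← sum_inv_mul_gram h, Finset.sum_mul]
    refine Finset.sum_congr rfl fun i _ => ?_
    rw [gram_inv_symm i j]; ring
  simp [this]

theorem lorentz_normalPartCoord_partialDeriv (h : IsUnit (gram φ p).det) (w : Spacetime n)
    (k : Fin n) : lorentz (normalPartCoord φ p w) (partialDeriv k φ p) = 0 := by
  simp [normalPartCoord, lorentz_tangentPartCoord_partialDeriv h]

theorem normalPartCoord_partialDeriv (h : IsUnit (gram φ p).det) (k : Fin n) :
    normalPartCoord φ p (partialDeriv k φ p) = 0 := by
  rw [normalPartCoord, tangentPartCoord_eq_sum, sub_eq_zero]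
  have (i : Fin n) : ∑ j, (gram φ p)⁻¹ i j * lorentz (partialDeriv k φ p) (partialDeriv j φ p) =
      if i = k then 1 else 0 := by
    rw [← sum_inv_mul_gram h]
    exact Finset.sum_congr rfl fun j _ => by rw [gram_apply, lorentz_comm]
  simp [this]

theorem normalPartCoord_fderiv (h : IsUnit (gram φ p).det) (v : EuclideanSpace ℝ (Fin n)) :
    normalPartCoord φ p (fderiv ℝ φ p v) = 0 := by
  rw [fderiv_eq_sum_partialDeriv, normalPartCoord_eq, map_sum]
  simp [← normalPartCoord_eq, normalPartCoord_partialDeriv h]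

theorem lorentz_fderiv_of_normal {u : Spacetime n}
    (hu : ∀ i, lorentz u (partialDeriv i φ p) = 0) (v : EuclideanSpace ℝ (Fin n)) :
    lorentz u (fderiv ℝ φ p v) = 0 := by
  simp [fderiv_eq_sum_partialDeriv, lorentz_sum_right, hu]

/-- Null normal vectors `ξ`, `ν` with `⟨ξ, ν⟩ = -1` span the normal space. -/
theorem normal_eq_of_lorentz (h : IsUnit (gram φ p).det) {ξ ν u : Spacetime n}
    (hξ : ∀ i, lorentz ξ (partialDeriv i φ p) = 0) (hν : ∀ i, lorentz ν (partialDeriv i φ p) = 0)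
    (hξξ : lorentz ξ ξ = 0) (hνν : lorentz ν ν = 0) (hξν : lorentz ξ ν = -1)
    (hu : ∀ i, lorentz u (partialDeriv i φ p) = 0) :
    u = (-lorentz u ξ) • ν + (-lorentz u ν) • ξ := by
  have hνξ : lorentz ν ξ = -1 := by rw [lorentz_comm, hξν]
  let b : Option (Option (Fin n)) → Spacetime n
    | none => ξ
    | some none => ν
    | some (some i) => partialDeriv i φ p
  have key (c : Option (Option (Fin n)) → ℝ) (i : Fin n) :
      lorentz (∑ k, c k • b k) (partialDeriv i φ p) =
        ∑ j, c (some (some j)) * gram φ p j i := by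
    simp [Fintype.sum_option, b, lorentz_sum_left, hξ, hν, gram_apply]
  -- Nondegeneracy of the Gram matrix kills the tangential coefficients of any combination normal to
  -- `φ`. This serves both the independence of `b` (zero combination) and the expansion of `u`.
  have coef (c : Option (Option (Fin n)) → ℝ)
      (hc : ∀ i, lorentz (∑ k, c k • b k) (partialDeriv i φ p) = 0) (j : Fin n) :
      c (some (some j)) = 0 := by
    have h1 : Matrix.vecMul (fun j => c (some (some j))) (gram φ p) = 0 := by
      ext i
      exact (key c i).symm.trans (hc i)
    exact congrFun (Matrix.eq_zero_of_vecMul_eq_zero h.ne_zero h1) j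
  have sum_eq (c : Option (Option (Fin n)) → ℝ) (hc : ∀ j, c (some (some j)) = 0) :
      ∑ k, c k • b k = c none • ξ + c (some none) • ν := by
    simp [Fintype.sum_option, b, hc]
  have hli : LinearIndependent ℝ b := by
    rw [Fintype.linearIndependent_iff]
    intro c hc
    have hj := coef c (by simp [hc])
    rw [sum_eq c hj] at hc
    have h0 : lorentz (c none • ξ + c (some none) • ν) ν = 0 := by simp [hc]
    have h1 : lorentz (c none • ξ + c (some none) • ν) ξ = 0 := by simp [hc]
    simp only [lorentz_add_left, lorentz_smul_left, hξν, hνν, hξξ, hνξ] at h0 h1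
    rintro (_ | _ | j)
    · linarith
    · linarith
    · exact hj j
  -- Two null vectors and `n` tangent vectors: exactly the dimension `n + 2`.
  have hspan := hli.span_eq_top_of_card_eq_finrank' (by simp)
  have hu' : u ∈ Submodule.span ℝ (Set.range b) := by rw [hspan]; trivial
  obtain ⟨c, rfl⟩ := (Submodule.mem_span_range_iff_exists_fun ℝ).1 hu'
  rw [sum_eq c (coef c hu)]
  simp only [lorentz_add_left, lorentz_smul_left, hξν, hνν, hξξ, hνξ]
  simp [add_comm]

end Pointwise

/-! ### The null normal frame and the algebra of the second fundamental form -/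

section NullFrame

variable {n : ℕ} {φ : EuclideanSpace ℝ (Fin n) → Spacetime n} {p : EuclideanSpace ℝ (Fin n)}

/-- The null normal vector `η` with `⟨φ, η⟩ = -1`, for a parametrization `φ` in the light cone. -/
def nullNormalCoord (φ : EuclideanSpace ℝ (Fin n) → Spacetime n) (p : EuclideanSpace ℝ (Fin n)) :
    Spacetime n :=
  -- The normal part of `timeVec` pairs with `φ p` to `-φ p 0`, so dividing by `φ p 0` gives a
  -- normal vector `T` with `⟨T, φ⟩ = -1`. Adding `(⟨T, T⟩ / 2) φ` keeps this pairing, as `φ` is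
  -- null, and makes the square `⟨T, T⟩ - ⟨T, T⟩ = 0`.
  (φ p 0)⁻¹ • normalPartCoord φ p (timeVec n) +
    (((φ p 0)⁻¹ ^ 2 * lorentz (normalPartCoord φ p (timeVec n))
      (normalPartCoord φ p (timeVec n))) / 2) • φ p

theorem lorentz_nullNormalCoord_partialDeriv (h : IsUnit (gram φ p).det)
    (hξ : ∀ i, lorentz (φ p) (partialDeriv i φ p) = 0) (i : Fin n) :
    lorentz (nullNormalCoord φ p) (partialDeriv i φ p) = 0 := by
  simp [nullNormalCoord, lorentz_normalPartCoord_partialDeriv h, hξ]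

theorem lorentz_self_nullNormalCoord (hξ : ∀ i, lorentz (φ p) (partialDeriv i φ p) = 0)
    (hnull : lorentz (φ p) (φ p) = 0) (hpos : 0 < φ p 0) :
    lorentz (φ p) (nullNormalCoord φ p) = -1 := by
  rw [lorentz_comm]
  simp only [nullNormalCoord, lorentz_add_left, lorentz_smul_left, hnull,
    lorentz_normalPartCoord_of_normal hξ, lorentz_timeVec]
  field_simp
  simp

theorem lorentz_nullNormalCoord_self (hξ : ∀ i, lorentz (φ p) (partialDeriv i φ p) = 0)
    (hnull : lorentz (φ p) (φ p) = 0) (hpos : 0 < φ p 0) :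
    lorentz (nullNormalCoord φ p) (nullNormalCoord φ p) = 0 := by
  have h1 := lorentz_normalPartCoord_of_normal (w := timeVec n) hξ
  simp only [nullNormalCoord, lorentz_add_left, lorentz_smul_left, lorentz_add_right,
    lorentz_smul_right, hnull, h1, lorentz_comm (φ p) (normalPartCoord _ _ _), lorentz_timeVec]
  field_simp
  ring

/-- At `p`, the map `φ` has a nondegenerate induced metric, lies in the future light cone
and is normal to itself. -/
structure IsConePoint (φ : EuclideanSpace ℝ (Fin n) → Spacetime n)
    (p : EuclideanSpace ℝ (Fin n)) : Prop where
  isUnit_det : IsUnit (gram φ p).det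
  normal : ∀ i, lorentz (φ p) (partialDeriv i φ p) = 0
  null : lorentz (φ p) (φ p) = 0
  pos : 0 < φ p 0

theorem lorentz_secondFormCoord_partialDeriv (h : IsUnit (gram φ p).det) (i j k : Fin n) :
    lorentz (secondFormCoord φ i j p) (partialDeriv k φ p) = 0 :=
  lorentz_normalPartCoord_partialDeriv h _ _

theorem lorentz_meanCurvatureCoord_partialDeriv (h : IsUnit (gram φ p).det) (k : Fin n) :
    lorentz (meanCurvatureCoord φ p) (partialDeriv k φ p) = 0 := by
  simp [meanCurvatureCoord, lorentz_sum_left, lorentz_secondFormCoord_partialDeriv h]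

theorem sum_inv_mul_gram_self (h : IsUnit (gram φ p).det) :
    ∑ i, ∑ j, (gram φ p)⁻¹ i j * gram φ p i j = n := by
  have (i : Fin n) : ∑ j, (gram φ p)⁻¹ i j * gram φ p i j = 1 := by
    have h1 := sum_inv_mul_gram h i i
    rw [if_pos rfl] at h1
    rw [← h1]
    exact Finset.sum_congr rfl fun j _ => by rw [gram_symm i j]
  simp [this]

theorem lorentz_meanCurvatureCoord_self (hn : n ≠ 0) (h : IsUnit (gram φ p).det)
    (hII : ∀ i j, lorentz (secondFormCoord φ i j p) (φ p) = -gram φ p i j) :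
    lorentz (meanCurvatureCoord φ p) (φ p) = -1 := by
  simp only [meanCurvatureCoord, lorentz_smul_left, lorentz_sum_left, hII, mul_neg,
    Finset.sum_neg_distrib, sum_inv_mul_gram_self h]
  have : (n : ℝ) ≠ 0 := by exact_mod_cast hn
  field_simp

/-- Raising both indices of `g` yields `g⁻¹`. This evaluates the cross terms `g ⊗ a` of `⟨II, II⟩`.
-/
theorem sum_inv_inv_gram_mul (h : IsUnit (gram φ p).det) (a : Fin n → Fin n → ℝ) :
    ∑ i, ∑ j, ∑ k, ∑ l, (gram φ p)⁻¹ i k * (gram φ p)⁻¹ j l * (gram φ p i j * a k l) =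
      ∑ k, ∑ l, (gram φ p)⁻¹ k l * a k l := by
  have h1 (j k l : Fin n) : ∑ i, (gram φ p)⁻¹ i k * (gram φ p)⁻¹ j l * (gram φ p i j * a k l) =
      (if k = j then 1 else 0) * ((gram φ p)⁻¹ j l * a k l) := by
    rw [← sum_inv_mul_gram h, Finset.sum_mul]
    refine Finset.sum_congr rfl fun i _ => ?_
    rw [gram_inv_symm i k]; ring
  rw [Finset.sum_comm]
  have h2 (j : Fin n) : ∑ i, ∑ k, ∑ l,
      (gram φ p)⁻¹ i k * (gram φ p)⁻¹ j l * (gram φ p i j * a k l) =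
      ∑ l, (gram φ p)⁻¹ j l * a j l := by
    rw [Finset.sum_comm]
    simp_rw [Finset.sum_comm (s := Finset.univ (α := Fin n)) (t := Finset.univ)
      (f := fun i l => _ * _ * (gram φ p i j * a _ l)), h1]
    rw [Finset.sum_comm]
    simp
  simp_rw [h2]

/-- With `II = g ⊗ η + a ⊗ φ` and both frame vectors null, the two cross terms give `⟨II, II⟩ = -2
tr a`; likewise `⟨H, H⟩ = 2 ⟨H, η⟩ = -(2 / n) tr a`. -/
theorem secondFormSqCoord_eq (hn : n ≠ 0) (hp : IsConePoint φ p)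
    (hII : ∀ i j, lorentz (secondFormCoord φ i j p) (φ p) = -gram φ p i j) :
    secondFormSqCoord φ p = n * lorentz (meanCurvatureCoord φ p) (meanCurvatureCoord φ p) := by
  have h := hp.isUnit_det
  obtain ⟨η, hη⟩ : ∃ η, η = nullNormalCoord φ p := ⟨_, rfl⟩
  have hηη : lorentz η η = 0 := hη ▸ lorentz_nullNormalCoord_self hp.normal hp.null hp.pos
  have hξη : lorentz (φ p) η = -1 := hη ▸ lorentz_self_nullNormalCoord hp.normal hp.null hp.pos
  have hηξ : lorentz η (φ p) = -1 := by rw [lorentz_comm, hξη]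
  have hηn : ∀ i, lorentz η (partialDeriv i φ p) = 0 :=
    fun i => hη ▸ lorentz_nullNormalCoord_partialDeriv h hp.normal i
  have dec (i j : Fin n) : secondFormCoord φ i j p =
      gram φ p i j • η + (-lorentz (secondFormCoord φ i j p) η) • φ p := by
    conv_lhs => rw [normal_eq_of_lorentz h hp.normal hηn hp.null hηη hξη
      (lorentz_secondFormCoord_partialDeriv h i j), hII, neg_neg]
  generalize ha : (fun i j => -lorentz (secondFormCoord φ i j p) η) = a at dec
  have dec' (i j : Fin n) : secondFormCoord φ i j p = gram φ p i j • η + a i j • φ p := by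
    rw [dec i j, ← ha]
  have hH := normal_eq_of_lorentz h hp.normal hηn hp.null hηη hξη
    (lorentz_meanCurvatureCoord_partialDeriv h)
  rw [lorentz_meanCurvatureCoord_self hn h hII, neg_neg, one_smul] at hH
  have hHη : lorentz (meanCurvatureCoord φ p) η =
      -((1 / n) * ∑ k, ∑ l, (gram φ p)⁻¹ k l * a k l) := by
    simp only [meanCurvatureCoord, lorentz_smul_left, lorentz_sum_left, dec', lorentz_add_left,
      hηη, hξη]
    simp
  have hHH : lorentz (meanCurvatureCoord φ p) (meanCurvatureCoord φ p) =
      2 * lorentz (meanCurvatureCoord φ p) η := by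
    conv_lhs => rw [hH]
    simp only [lorentz_add_left, lorentz_smul_left, lorentz_add_right,
      lorentz_smul_right, hηη, hξη, hηξ, hp.null]
    ring
  have hs (i j k l : Fin n) : (gram φ p)⁻¹ i k * (gram φ p)⁻¹ j l *
      lorentz (secondFormCoord φ i j p) (secondFormCoord φ k l p) =
      -((gram φ p)⁻¹ i k * (gram φ p)⁻¹ j l * (gram φ p i j * a k l)) -
      (gram φ p)⁻¹ k i * (gram φ p)⁻¹ l j * (gram φ p k l * a i j) := by
    rw [dec', dec', gram_inv_symm k i, gram_inv_symm l j]
    simp only [lorentz_add_left, lorentz_smul_left, lorentz_add_right,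
      lorentz_smul_right, hηη, hξη, hηξ, hp.null]
    ring
  -- The two cross terms are exchanged by the relabelling `(i, j) ↔ (k, l)`.
  have hswap : ∑ i, ∑ j, ∑ k, ∑ l, (gram φ p)⁻¹ k i * (gram φ p)⁻¹ l j * (gram φ p k l * a i j) =
      ∑ i, ∑ j, ∑ k, ∑ l, (gram φ p)⁻¹ i k * (gram φ p)⁻¹ j l * (gram φ p i j * a k l) := by
    simp only [← Fintype.sum_prod_type']
    refine Fintype.sum_equiv ⟨fun x => (x.2.2.1, x.2.2.2, x.1, x.2.1),
      fun x => (x.2.2.1, x.2.2.2, x.1, x.2.1), fun _ => rfl, fun _ => rfl⟩ _ _ fun _ => rfl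
  simp only [secondFormSqCoord, hs, Finset.sum_sub_distrib, Finset.sum_neg_distrib, hswap]
  rw [sum_inv_inv_gram_mul h, hHH, hHη]
  have : (n : ℝ) ≠ 0 := by exact_mod_cast hn
  field_simp
  ring

end NullFrame

/-! ### Coordinate calculus: smoothness, Christoffel symbols, Gauss equation -/

section Calculus

variable {n : ℕ} {φ : EuclideanSpace ℝ (Fin n) → Spacetime n} {p : EuclideanSpace ℝ (Fin n)}

theorem _root_.ContDiffAt.partialDeriv {F : Type*} [NormedAddCommGroup F] [NormedSpace ℝ F]
    {f : EuclideanSpace ℝ (Fin n) → F} (hf : ContDiffAt ℝ ∞ f p) (i : Fin n) :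
    ContDiffAt ℝ ∞ (partialDeriv i f) p :=
  (hf.fderiv_right (m := ∞) (by simp)).clm_apply contDiffAt_const

theorem _root_.ContDiffAt.lorentz {E : Type*} [NormedAddCommGroup E] [NormedSpace ℝ E] {x : E}
    {f g : E → Spacetime n}
    (hf : ContDiffAt ℝ ∞ f x) (hg : ContDiffAt ℝ ∞ g x) :
    ContDiffAt ℝ ∞ (fun q => lorentz (f q) (g q)) x :=
  ((lorentzL n).contDiff.contDiffAt.comp x hf).clm_apply hg

theorem hasFDerivAt_lorentz {E : Type*} [NormedAddCommGroup E] [NormedSpace ℝ E] {x : E}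
    {f g : E → Spacetime n} {f' g' : E →L[ℝ] Spacetime n}
    (hf : HasFDerivAt f f' x) (hg : HasFDerivAt g g' x) :
    HasFDerivAt (fun q => lorentz (f q) (g q))
      ((lorentzL n (f x)).comp g' + ((lorentzL n).flip (g x)).comp f') x := by
  have := (((lorentzL n).hasFDerivAt (x := f x)).comp x hf).clm_apply hg
  exact this

theorem partialDeriv_lorentz {f g : EuclideanSpace ℝ (Fin n) → Spacetime n}
    (hf : DifferentiableAt ℝ f p) (hg : DifferentiableAt ℝ g p) (i : Fin n) :
    partialDeriv i (fun q => lorentz (f q) (g q)) p =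
      lorentz (partialDeriv i f p) (g p) + lorentz (f p) (partialDeriv i g p) := by
  rw [partialDeriv, (hasFDerivAt_lorentz hf.hasFDerivAt hg.hasFDerivAt).fderiv, add_comm]
  rfl

theorem partialDeriv_congr {F : Type*} [NormedAddCommGroup F] [NormedSpace ℝ F]
    {f g : EuclideanSpace ℝ (Fin n) → F} (h : f =ᶠ[nhds p] g) (i : Fin n) :
    partialDeriv i f p = partialDeriv i g p := by
  rw [partialDeriv, h.fderiv_eq, partialDeriv]

theorem partialDeriv_comm {F : Type*} [NormedAddCommGroup F] [NormedSpace ℝ F]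
    {f : EuclideanSpace ℝ (Fin n) → F} (hf : ContDiffAt ℝ ∞ f p) (i j : Fin n) :
    partialDeriv i (partialDeriv j f) p = partialDeriv j (partialDeriv i f) p := by
  have hd : DifferentiableAt ℝ (fderiv ℝ f) p :=
    (hf.fderiv_right (m := ∞) (by simp)).differentiableAt (by simp)
  have key (i j : Fin n) : partialDeriv i (partialDeriv j f) p =
      fderiv ℝ (fderiv ℝ f) p (coordVec i) (coordVec j) := by
    have := (hd.hasFDerivAt.clm_apply (hasFDerivAt_const (coordVec j) p)).fderiv
    change fderiv ℝ (fun q => fderiv ℝ f q (coordVec j)) p (coordVec i) = _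
    rw [this]
    simp
  rw [key, key]
  exact (hf.isSymmSndFDerivAt (by simp; exact WithTop.coe_le_coe.2 (le_top : (2 : ℕ∞) ≤ ⊤))).eq _ _

theorem contDiffAt_det {E : Type*} [NormedAddCommGroup E] [NormedSpace ℝ E] {x : E}
    {A : E → Matrix (Fin n) (Fin n) ℝ} (hA : ∀ i j, ContDiffAt ℝ ∞ (fun q => A q i j) x) :
    ContDiffAt ℝ ∞ (fun q => (A q).det) x := by
  simp only [Matrix.det_apply']
  exact ContDiffAt.sum fun σ _ => contDiffAt_const.mul (contDiffAt_prod fun i _ => hA _ _)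

theorem contDiffAt_matrix_inv {E : Type*} [NormedAddCommGroup E] [NormedSpace ℝ E] {x : E}
    {A : E → Matrix (Fin n) (Fin n) ℝ} (hA : ∀ i j, ContDiffAt ℝ ∞ (fun q => A q i j) x)
    (h : IsUnit (A x).det) (i j : Fin n) :
    ContDiffAt ℝ ∞ (fun q => (A q)⁻¹ i j) x := by
  simp only [Matrix.inv_def, Ring.inverse_eq_inv', Matrix.smul_apply, Matrix.adjugate_apply,
    smul_eq_mul]
  refine ((contDiffAt_det hA).inv h.ne_zero).mul (contDiffAt_det fun k l => ?_)
  by_cases hk : k = j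
  · subst hk; simpa using contDiffAt_const
  · simpa [Matrix.updateRow_ne hk] using hA k l

theorem contDiffAt_gram (hφ : ContDiffAt ℝ ∞ φ p) (i j : Fin n) :
    ContDiffAt ℝ ∞ (fun q => gram φ q i j) p :=
  (hφ.partialDeriv i).lorentz (hφ.partialDeriv j)

theorem contDiffAt_gram_inv (hφ : ContDiffAt ℝ ∞ φ p) (h : IsUnit (gram φ p).det) (i j : Fin n) :
    ContDiffAt ℝ ∞ (fun q => (gram φ q)⁻¹ i j) p :=
  contDiffAt_matrix_inv (contDiffAt_gram hφ) h i j

theorem eventually_isUnit_det_gram (hφ : ContDiffAt ℝ ∞ φ p) (h : IsUnit (gram φ p).det) :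
    ∀ᶠ q in nhds p, IsUnit (gram φ q).det := by
  simp only [isUnit_iff_ne_zero] at h ⊢
  exact (contDiffAt_det (contDiffAt_gram hφ)).continuousAt.eventually_ne h

theorem contDiffAt_normalPartCoord (hφ : ContDiffAt ℝ ∞ φ p) (h : IsUnit (gram φ p).det)
    (w : Spacetime n) : ContDiffAt ℝ ∞ (fun q => normalPartCoord φ q w) p := by
  simp only [normalPartCoord, tangentPartCoord]
  exact contDiffAt_const.sub (ContDiffAt.sum fun i _ => ContDiffAt.sum fun j _ =>
    ((contDiffAt_gram_inv hφ h i j).mul (contDiffAt_const.lorentz (hφ.partialDeriv j))).smul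
      (hφ.partialDeriv i))

theorem contDiffAt_nullNormalCoord (hφ : ContDiffAt ℝ ∞ φ p) (h : IsUnit (gram φ p).det)
    (hpos : 0 < φ p 0) : ContDiffAt ℝ ∞ (nullNormalCoord φ) p := by
  have h1 := contDiffAt_normalPartCoord hφ h (timeVec n)
  have h0 : ContDiffAt ℝ ∞ (fun q => (φ q 0)⁻¹) p :=
    ((contDiffAt_euclidean.1 hφ) 0).inv hpos.ne'
  exact (h0.smul h1).add ((((h0.pow 2).mul (h1.lorentz h1)).div_const 2).smul hφ)

/-- Expanding each `∂ g` by the product rule and commuting second derivatives, all terms but twice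
`⟨∂_i ∂_j φ, ∂_l φ⟩` cancel. -/
theorem christoffel_gram (hφ : ContDiffAt ℝ ∞ φ p) (k i j : Fin n) :
    christoffel (gram φ) k i j p = ∑ l, (gram φ p)⁻¹ k l *
      lorentz (partialDeriv i (partialDeriv j φ) p) (partialDeriv l φ p) := by
  have hd (i : Fin n) : DifferentiableAt ℝ (partialDeriv i φ) p :=
    (hφ.partialDeriv i).differentiableAt (by simp)
  have key (i j l : Fin n) : partialDeriv i (fun q => gram φ q j l) p =
      lorentz (partialDeriv i (partialDeriv j φ) p) (partialDeriv l φ p) +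
        lorentz (partialDeriv i (partialDeriv l φ) p) (partialDeriv j φ p) := by
    rw [lorentz_comm (partialDeriv i (partialDeriv l φ) p)]
    exact partialDeriv_lorentz (hd j) (hd l) i
  rw [christoffel, Finset.mul_sum]
  refine Finset.sum_congr rfl fun l _ => ?_
  rw [key, key, key, partialDeriv_comm hφ j i, partialDeriv_comm hφ l i, partialDeriv_comm hφ l j]
  ring

theorem sum_christoffel_smul (hφ : ContDiffAt ℝ ∞ φ p) (i j : Fin n) :
    ∑ k, christoffel (gram φ) k i j p • partialDeriv k φ p =
      tangentPartCoord φ p (partialDeriv i (partialDeriv j φ) p) := by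
  simp only [tangentPartCoord_eq_sum, christoffel_gram hφ]

theorem sum_christoffel_mul_lorentz (hφ : ContDiffAt ℝ ∞ φ p) (i j : Fin n) (w : Spacetime n) :
    ∑ k, christoffel (gram φ) k i j p * lorentz (partialDeriv k φ p) w =
      lorentz (tangentPartCoord φ p (partialDeriv i (partialDeriv j φ) p)) w := by
  rw [← sum_christoffel_smul hφ, lorentz_sum_left]
  simp

theorem contDiffAt_christoffel (hφ : ∀ᶠ q in nhds p, ContDiffAt ℝ ∞ φ q)
    (h : IsUnit (gram φ p).det) (k i j : Fin n) :
    ContDiffAt ℝ ∞ (christoffel (gram φ) k i j) p := by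
  have hp := hφ.self_of_nhds
  refine ContDiffAt.congr_of_eventuallyEq (f := fun q => ∑ l, (gram φ q)⁻¹ k l *
    lorentz (partialDeriv i (partialDeriv j φ) q) (partialDeriv l φ q)) ?_
    (hφ.mono fun q hq => christoffel_gram hq k i j)
  exact ContDiffAt.sum fun l _ => (contDiffAt_gram_inv hp h k l).mul
    (((hp.partialDeriv j).partialDeriv i).lorentz (hp.partialDeriv l))

theorem secondFormCoord_symm (hφ : ContDiffAt ℝ ∞ φ p) (i j : Fin n) :
    secondFormCoord φ i j p = secondFormCoord φ j i p := by
  rw [secondFormCoord, partialDeriv_comm hφ, secondFormCoord]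

theorem lorentz_secondFormCoord_secondFormCoord (h : IsUnit (gram φ p).det) (i j k l : Fin n) :
    lorentz (secondFormCoord φ i j p) (partialDeriv k (partialDeriv l φ) p) =
      lorentz (secondFormCoord φ i j p) (secondFormCoord φ k l p) := by
  rw [lorentz_comm, lorentz_comm _ (secondFormCoord φ k l p)]
  exact (lorentz_normalPartCoord_of_normal (lorentz_secondFormCoord_partialDeriv h i j)).symm

/-- Half of the Gauss equation: differentiate `∑ Γ^l_jk g_ls = ⟨∂_j ∂_k φ, ∂_s φ⟩` along `∂_i`.
Pairing `∂_j ∂_k φ` minus its tangential part with `∂_i ∂_s φ` leaves the product of second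
fundamental forms. -/
theorem sum_gram_mul_partialDeriv_christoffel (hφ : ∀ᶠ q in nhds p, ContDiffAt ℝ ∞ φ q)
    (h : IsUnit (gram φ p).det) (i j k s : Fin n) :
    ∑ l, gram φ p l s * (partialDeriv i (christoffel (gram φ) l j k) p +
      ∑ m, christoffel (gram φ) m j k p * christoffel (gram φ) l i m p) =
      lorentz (partialDeriv i (partialDeriv j (partialDeriv k φ)) p) (partialDeriv s φ p) +
      lorentz (secondFormCoord φ j k p) (secondFormCoord φ i s p) := by
  have hp := hφ.self_of_nhds
  have hd (i : Fin n) : DifferentiableAt ℝ (partialDeriv i φ) p :=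
    (hp.partialDeriv i).differentiableAt (by simp)
  have hd2 (i j : Fin n) : DifferentiableAt ℝ (partialDeriv i (partialDeriv j φ)) p :=
    ((hp.partialDeriv j).partialDeriv i).differentiableAt (by simp)
  have hdΓ (l j k : Fin n) : DifferentiableAt ℝ (christoffel (gram φ) l j k) p :=
    (contDiffAt_christoffel hφ h l j k).differentiableAt (by simp)
  have hdg (l s : Fin n) : DifferentiableAt ℝ (fun q => gram φ q l s) p :=
    (contDiffAt_gram hp l s).differentiableAt (by simp)
  have hev : (fun q => ∑ l, christoffel (gram φ) l j k q * gram φ q l s) =ᶠ[nhds p]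
      fun q => lorentz (partialDeriv j (partialDeriv k φ) q) (partialDeriv s φ q) := by
    filter_upwards [hφ, eventually_isUnit_det_gram hp h] with q hq hu
    simp only [gram_apply]
    rw [sum_christoffel_mul_lorentz hq, lorentz_tangentPartCoord_partialDeriv hu]
  have h1 := partialDeriv_congr hev i
  rw [partialDeriv_lorentz (hd2 j k) (hd s)] at h1
  have h2 : partialDeriv i (fun q => ∑ l, christoffel (gram φ) l j k q * gram φ q l s) p =
      ∑ l, (gram φ p l s * partialDeriv i (christoffel (gram φ) l j k) p +
        (christoffel (gram φ) l j k p * lorentz (partialDeriv i (partialDeriv l φ) p)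
          (partialDeriv s φ p) + christoffel (gram φ) l j k p *
            lorentz (partialDeriv l φ p) (partialDeriv i (partialDeriv s φ) p))) := by
    rw [partialDeriv, fderiv_fun_sum (A := fun l q => christoffel (gram φ) l j k q * gram φ q l s)
      fun l _ => (hdΓ l j k).fun_mul (hdg l s), _root_.sum_apply]
    refine Finset.sum_congr rfl fun l _ => ?_
    rw [fderiv_fun_mul (hdΓ l j k) (hdg l s)]
    have := partialDeriv_lorentz (hd l) (hd s) i
    simp only [_root_.add_apply, _root_.smul_apply, smul_eq_mul]
    change _ * partialDeriv i (fun q => lorentz (partialDeriv l φ q) (partialDeriv s φ q)) p +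
      _ * partialDeriv i (christoffel (gram φ) l j k) p = _
    rw [this]; ring
  have h3 : ∑ l, gram φ p l s * ∑ m, christoffel (gram φ) m j k p * christoffel (gram φ) l i m p =
      ∑ m, christoffel (gram φ) m j k p *
        lorentz (partialDeriv i (partialDeriv m φ) p) (partialDeriv s φ p) := by
    simp_rw [← lorentz_tangentPartCoord_partialDeriv h (partialDeriv i (partialDeriv _ φ) p),
      ← sum_christoffel_mul_lorentz hp, Finset.mul_sum, gram_apply]
    rw [Finset.sum_comm]
    refine Finset.sum_congr rfl fun m _ => Finset.sum_congr rfl fun l _ => by ring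
  rw [h2, Finset.sum_add_distrib, Finset.sum_add_distrib, sum_christoffel_mul_lorentz hp] at h1
  simp_rw [mul_add, Finset.sum_add_distrib]
  rw [h3, ← lorentz_secondFormCoord_secondFormCoord h j k i s]
  simp only [secondFormCoord, normalPartCoord, lorentz_sub_left]
  linarith

/-- The Gauss equation. -/
theorem sum_gram_mul_riemann (hφ : ∀ᶠ q in nhds p, ContDiffAt ℝ ∞ φ q)
    (h : IsUnit (gram φ p).det) (i j k s : Fin n) :
    ∑ l, gram φ p l s * riemann (gram φ) l i j k p =
      lorentz (secondFormCoord φ j k p) (secondFormCoord φ i s p) -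
      lorentz (secondFormCoord φ i k p) (secondFormCoord φ j s p) := by
  have h1 := sum_gram_mul_partialDeriv_christoffel hφ h i j k s
  have h2 := sum_gram_mul_partialDeriv_christoffel hφ h j i k s
  -- The third-derivative terms are symmetric in `i, j`, so they cancel on antisymmetrizing.
  rw [partialDeriv_comm (hφ.self_of_nhds.partialDeriv k) j i] at h2
  have : ∑ l, gram φ p l s * riemann (gram φ) l i j k p =
      ∑ l, gram φ p l s * (partialDeriv i (christoffel (gram φ) l j k) p +
        ∑ m, christoffel (gram φ) m j k p * christoffel (gram φ) l i m p) -
      ∑ l, gram φ p l s * (partialDeriv j (christoffel (gram φ) l i k) p +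
        ∑ m, christoffel (gram φ) m i k p * christoffel (gram φ) l j m p) := by
    rw [← Finset.sum_sub_distrib]
    refine Finset.sum_congr rfl fun l _ => ?_
    rw [riemann, Finset.sum_sub_distrib]; ring
  rw [this, h1, h2]; ring

theorem ricci_gram (hφ : ∀ᶠ q in nhds p, ContDiffAt ℝ ∞ φ q)
    (h : IsUnit (gram φ p).det) (j k : Fin n) :
    ricci (gram φ) j k p = ∑ i, ∑ s, (gram φ p)⁻¹ i s *
      (lorentz (secondFormCoord φ j k p) (secondFormCoord φ i s p) -
      lorentz (secondFormCoord φ i k p) (secondFormCoord φ j s p)) := by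
  refine Finset.sum_congr rfl fun i _ => ?_
  simp_rw [← sum_gram_mul_riemann hφ h, Finset.mul_sum]
  rw [Finset.sum_comm]
  have (l : Fin n) : ∑ s, (gram φ p)⁻¹ i s * (gram φ p l s * riemann (gram φ) l i j k p) =
      (if i = l then 1 else 0) * riemann (gram φ) l i j k p := by
    rw [← sum_inv_mul_gram h, Finset.sum_mul]
    exact Finset.sum_congr rfl fun s _ => by rw [gram_symm l s, mul_assoc]
  simp [this]

/-- The double trace of the Gauss equation: its first term factors as `⟨tr II, tr II⟩` with `tr II =
n H`, and its second is `⟨II, II⟩` after relabelling, by the symmetry of `II` and `g⁻¹`. -/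
theorem scalarCurvatureCoord_gram (hn : n ≠ 0) (hφ : ∀ᶠ q in nhds p, ContDiffAt ℝ ∞ φ q)
    (h : IsUnit (gram φ p).det) :
    scalarCurvatureCoord (gram φ) p =
      n ^ 2 * lorentz (meanCurvatureCoord φ p) (meanCurvatureCoord φ p) -
        secondFormSqCoord φ p := by
  have hn' : (n : ℝ) ≠ 0 := by exact_mod_cast hn
  have h1 : (n : ℝ) ^ 2 * lorentz (meanCurvatureCoord φ p) (meanCurvatureCoord φ p) =
      ∑ j, ∑ k, ∑ i, ∑ s, (gram φ p)⁻¹ j k * ((gram φ p)⁻¹ i s *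
        lorentz (secondFormCoord φ j k p) (secondFormCoord φ i s p)) := by
    have : (n : ℝ) ^ 2 * (1 / n) * (1 / n) = 1 := by field_simp
    rw [meanCurvatureCoord, lorentz_smul_left, lorentz_smul_right, ← mul_assoc, ← mul_assoc, this,
      one_mul]
    simp only [lorentz_sum_left, lorentz_sum_right, lorentz_smul_left, lorentz_smul_right,
      Finset.mul_sum]
    refine Finset.sum_congr rfl fun j _ => Finset.sum_congr rfl fun k _ =>
      Finset.sum_congr rfl fun i _ => Finset.sum_congr rfl fun s _ => by rw [lorentz_comm]
  have h2 : secondFormSqCoord φ p = ∑ j, ∑ k, ∑ i, ∑ s, (gram φ p)⁻¹ j k * ((gram φ p)⁻¹ i s *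
        lorentz (secondFormCoord φ i k p) (secondFormCoord φ j s p)) := by
    simp only [secondFormSqCoord, ← Fintype.sum_prod_type']
    refine Fintype.sum_equiv ⟨fun x => (x.2.2.2, x.2.1, x.1, x.2.2.1),
      fun y => (y.2.2.1, y.2.1, y.2.2.2, y.1), fun _ => rfl, fun _ => rfl⟩ _ _ fun x => ?_
    simp only [Equiv.coe_fn_mk]
    rw [secondFormCoord_symm hφ.self_of_nhds x.2.2.1, gram_inv_symm x.2.1]
    ring
  rw [h1, h2]
  simp only [scalarCurvatureCoord, ricci_gram hφ h, Finset.mul_sum, mul_sub,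
    Finset.sum_sub_distrib]

theorem lorentz_partialDeriv_of_null (hφ : DifferentiableAt ℝ φ p)
    (hnull : ∀ᶠ q in nhds p, lorentz (φ q) (φ q) = 0) (i : Fin n) :
    lorentz (φ p) (partialDeriv i φ p) = 0 := by
  have h1 := partialDeriv_congr (g := fun _ => (0 : ℝ)) hnull i
  rw [partialDeriv_lorentz hφ hφ, lorentz_comm (partialDeriv i φ p)] at h1
  have : partialDeriv i (fun _ => (0 : ℝ)) p = 0 := by simp [partialDeriv]
  linarith

/-- Differentiate `⟨φ, ∂_j φ⟩ = 0`, valid near `p`, along `∂_i`; since `φ` is normal, projecting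
`∂_i ∂_j φ` does not change its pairing with `φ`. -/
theorem lorentz_secondFormCoord_of_null (hφ : ∀ᶠ q in nhds p, ContDiffAt ℝ ∞ φ q)
    (hnull : ∀ᶠ q in nhds p, lorentz (φ q) (φ q) = 0) (i j : Fin n) :
    lorentz (secondFormCoord φ i j p) (φ p) = -gram φ p i j := by
  have hp := hφ.self_of_nhds
  have hn (j : Fin n) : ∀ᶠ q in nhds p, lorentz (φ q) (partialDeriv j φ q) = 0 := by
    filter_upwards [hφ, hnull.eventually_nhds] with q hq hq'
    exact lorentz_partialDeriv_of_null (hq.differentiableAt (by simp)) hq' j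
  rw [secondFormCoord, lorentz_normalPartCoord_of_normal fun j => (hn j).self_of_nhds]
  have h1 := partialDeriv_congr (g := fun _ => (0 : ℝ)) (hn j) i
  rw [partialDeriv_lorentz (hp.differentiableAt (by simp))
    ((hp.partialDeriv j).differentiableAt (by simp)), lorentz_comm (φ p)] at h1
  have : partialDeriv i (fun _ => (0 : ℝ)) p = 0 := by simp [partialDeriv]
  rw [gram_apply]
  linarith

end Calculus

theorem isConst_const_mul_iff {M : Type*} {f g : M → ℝ} {c : ℝ} (hc : c ≠ 0)
    (h : ∀ x, g x = c * f x) :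
    IsConst g ↔ IsConst f := by
  constructor
  · rintro ⟨a, ha⟩
    exact ⟨a / c, fun x => by rw [← ha x, h x]; field_simp⟩
  · rintro ⟨a, ha⟩
    exact ⟨c * a, fun x => by rw [h x, ha x]⟩

/-! ### Derivatives of vector-valued maps on the manifold -/

section ManifoldCalculus

variable {n : ℕ} {M : Type*} [TopologicalSpace M] [ChartedSpace (EuclideanSpace ℝ (Fin n)) M]
  {F : Type*} [NormedAddCommGroup F] [NormedSpace ℝ F]

theorem differentiableAt_comp_extChartAt_symm {f : M → F} {x : M}
    (hf : MDifferentiableAt (𝓡 n) 𝓘(ℝ, F) f x) :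
    DifferentiableAt ℝ (f ∘ (extChartAt (𝓡 n) x).symm) (extChartAt (𝓡 n) x x) := by
  have := hf.differentiableWithinAt_writtenInExtChartAt
  rw [ModelWithCorners.range_eq_univ, differentiableWithinAt_univ] at this
  exact this

/-- The derivative of `f` at `x` in the preferred chart at `x`. -/
def chartDeriv (f : M → F) (x : M) : EuclideanSpace ℝ (Fin n) →L[ℝ] F :=
  fderiv ℝ (f ∘ (extChartAt (𝓡 n) x).symm) (extChartAt (𝓡 n) x x)

theorem hasFDerivAt_chartDeriv {f : M → F} {x : M} (hf : MDifferentiableAt (𝓡 n) 𝓘(ℝ, F) f x) :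
    HasFDerivAt (f ∘ (extChartAt (𝓡 n) x).symm) (chartDeriv f x) (extChartAt (𝓡 n) x x) :=
  (differentiableAt_comp_extChartAt_symm hf).hasFDerivAt

theorem mfderiv_eq_chartDeriv {f : M → F} {x : M}
    (hf : MDifferentiableAt (𝓡 n) 𝓘(ℝ, F) f x) :
    mfderiv (𝓡 n) 𝓘(ℝ, F) f x = chartDeriv f x := by
  have h : mfderiv (𝓡 n) 𝓘(ℝ, F) f x =
      fderivWithin ℝ (f ∘ (extChartAt (𝓡 n) x).symm) (Set.range (𝓡 n)) (extChartAt (𝓡 n) x x) :=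
    if_pos hf
  rw [h, ModelWithCorners.range_eq_univ, fderivWithin_univ, chartDeriv]

theorem mdifferentiableAt_lorentz {f g : M → Spacetime n} {x : M}
    (hf : MDifferentiableAt (𝓡 n) 𝓘(ℝ, Spacetime n) f x)
    (hg : MDifferentiableAt (𝓡 n) 𝓘(ℝ, Spacetime n) g x) :
    MDifferentiableAt (𝓡 n) 𝓘(ℝ, ℝ) (fun y => lorentz (f y) (g y)) x := by
  have h1 : MDifferentiableAt (𝓡 n) 𝓘(ℝ, Spacetime n →L[ℝ] ℝ) (fun y => lorentzL n (f y)) x :=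
    (lorentzL n).differentiable.differentiableAt.mdifferentiableAt.comp x hf
  exact h1.clm_apply hg

theorem chartDeriv_lorentz {f g : M → Spacetime n} {x : M}
    (hf : MDifferentiableAt (𝓡 n) 𝓘(ℝ, Spacetime n) f x)
    (hg : MDifferentiableAt (𝓡 n) 𝓘(ℝ, Spacetime n) g x) (v : EuclideanSpace ℝ (Fin n)) :
    chartDeriv (fun y => lorentz (f y) (g y)) x v =
      lorentz (chartDeriv f x v) (g x) + lorentz (f x) (chartDeriv g x v) := by
  have h := hasFDerivAt_lorentz (hasFDerivAt_chartDeriv hf) (hasFDerivAt_chartDeriv hg)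
  change fderiv ℝ (fun q => lorentz ((f ∘ (extChartAt (𝓡 n) x).symm) q)
    ((g ∘ (extChartAt (𝓡 n) x).symm) q)) _ v = _
  rw [h.fderiv, add_comm]
  simp only [Function.comp_apply, extChartAt_to_inv]
  rfl

variable [IsManifold (𝓡 n) ∞ M]

theorem mdifferentiableAt_extChartAt_symm_of_mem {x : M} {q : EuclideanSpace ℝ (Fin n)}
    (hq : q ∈ (extChartAt (𝓡 n) x).target) :
    MDifferentiableAt 𝓘(ℝ, EuclideanSpace ℝ (Fin n)) (𝓡 n) (extChartAt (𝓡 n) x).symm q :=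
  (((contMDiffOn_extChartAt_symm (n := ∞) x) q hq).contMDiffAt
    ((isOpen_extChartAt_target x).mem_nhds hq)).mdifferentiableAt (by simp)

/-- The hypothesis only concerns the centre of each preferred chart. The chain rule carries it to
every point of a fixed chart, so `f` is constant on a coordinate ball, hence locally constant, and
connectedness concludes. -/
theorem isConst_of_chartDeriv_eq_zero [PreconnectedSpace M] [Nonempty M] {f : M → ℝ}
    (hf : MDifferentiable (𝓡 n) 𝓘(ℝ, ℝ) f)
    (h : ∀ (x : M) (v : EuclideanSpace ℝ (Fin n)), chartDeriv f x v = 0) :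
    IsConst f := by
  have hloc : IsLocallyConstant f := by
    rw [IsLocallyConstant.iff_eventually_eq]
    intro x
    have hd (q : EuclideanSpace ℝ (Fin n)) (hq : q ∈ (extChartAt (𝓡 n) x).target) :
        HasFDerivAt (f ∘ (extChartAt (𝓡 n) x).symm)
          (0 : EuclideanSpace ℝ (Fin n) →L[ℝ] ℝ) q := by
      have hs := mdifferentiableAt_extChartAt_symm_of_mem hq
      have h1 : MDifferentiableAt 𝓘(ℝ, EuclideanSpace ℝ (Fin n)) 𝓘(ℝ, ℝ)
          (f ∘ (extChartAt (𝓡 n) x).symm) q := (hf _).comp q hs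
      have h2 := mfderiv_comp q (hf ((extChartAt (𝓡 n) x).symm q)) hs
      rw [mfderiv_eq_fderiv, mfderiv_eq_chartDeriv (hf _)] at h2
      have h3 : fderiv ℝ (f ∘ (extChartAt (𝓡 n) x).symm) q = 0 := by
        ext v
        exact (congrArg (fun L => L v) h2).trans (h _ _)
      rw [← h3]
      exact h1.differentiableAt.hasFDerivAt
    obtain ⟨r, hr, hball⟩ := Metric.mem_nhds_iff.1
      ((isOpen_extChartAt_target (I := 𝓡 n) x).mem_nhds (mem_extChartAt_target x))
    have hc : ∀ q ∈ Metric.ball (extChartAt (𝓡 n) x x) r,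
        (f ∘ (extChartAt (𝓡 n) x).symm) q =
          (f ∘ (extChartAt (𝓡 n) x).symm) (extChartAt (𝓡 n) x x) := fun q hq =>
      Metric.isOpen_ball.is_const_of_fderiv_eq_zero (𝕜 := ℝ) (convex_ball _ _).isPreconnected
        (fun z hz => (hd z (hball hz)).differentiableAt.differentiableWithinAt)
        (fun z hz => (hd z (hball hz)).fderiv) hq (Metric.mem_ball_self hr)
    filter_upwards [(continuousAt_extChartAt (I := 𝓡 n) x).preimage_mem_nhds
      (Metric.ball_mem_nhds _ hr), extChartAt_source_mem_nhds (I := 𝓡 n) x] with y hy hys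
    have := hc _ hy
    rwa [Function.comp_apply, Function.comp_apply, (extChartAt (𝓡 n) x).left_inv hys,
      extChartAt_to_inv] at this
  obtain ⟨x₀⟩ := ‹Nonempty M›
  exact ⟨f x₀, fun x => hloc.apply_eq_of_preconnectedSpace x x₀⟩

end ManifoldCalculus

/-! ### The parallel null frame of a submanifold of the light cone -/

section ConeSubmanifold

variable {n : ℕ} {M : Type*} [TopologicalSpace M] [ChartedSpace (EuclideanSpace ℝ (Fin n)) M]
  {ψ ν : M → Spacetime n}

theorem param_extChartAt {x y : M} (hy : y ∈ (extChartAt (𝓡 n) x).source) :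
    param ψ x (extChartAt (𝓡 n) x y) = ψ y := by
  rw [param, Function.comp_apply, (extChartAt (𝓡 n) x).left_inv hy]

theorem param_self (x : M) : param ψ x (extChartAt (𝓡 n) x x) = ψ x :=
  param_extChartAt (mem_extChartAt_source x)

theorem partialDeriv_param (x : M) (i : Fin n) :
    partialDeriv i (param ψ x) (extChartAt (𝓡 n) x x) = chartDeriv ψ x (coordVec i) := rfl

/-- A kernel vector of the Gram matrix would give a nonzero tangent vector of zero length. -/
theorem isUnit_det_gram_param (hψ : MDifferentiable (𝓡 n) 𝓘(ℝ, Spacetime n) ψ)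
    (hs : IsSpacelike ψ) (x : M) :
    IsUnit (gram (param ψ x) (extChartAt (𝓡 n) x x)).det := by
  rw [isUnit_iff_ne_zero]
  intro h0
  obtain ⟨v, hv, hv0⟩ := Matrix.exists_mulVec_eq_zero_iff.2 h0
  let w : EuclideanSpace ℝ (Fin n) := WithLp.toLp 2 v
  have hw : w ≠ 0 := fun h => hv (by
    ext i; exact congrArg (fun u : EuclideanSpace ℝ (Fin n) => u i) h)
  have h1 := hs x w hw
  rw [mfderiv_eq_chartDeriv (hψ x)] at h1
  change 0 < lorentz (fderiv ℝ (param ψ x) _ w) (fderiv ℝ (param ψ x) _ w) at h1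
  rw [fderiv_eq_sum_partialDeriv, lorentz_sum_left] at h1
  refine h1.ne' (Finset.sum_eq_zero fun i _ => ?_)
  have h2 := congrFun hv0 i
  simp only [Matrix.mulVec, dotProduct, Pi.zero_apply, gram_apply] at h2
  rw [lorentz_smul_left, lorentz_sum_right]
  simp only [lorentz_smul_right]
  rw [← mul_zero (w i), ← h2]
  congr 1
  exact Finset.sum_congr rfl fun j _ => mul_comm _ _

theorem isNormalField_iff (hψ : MDifferentiable (𝓡 n) 𝓘(ℝ, Spacetime n) ψ) :
    IsNormalField ψ ν ↔
      ∀ x i, lorentz (ν x) (partialDeriv i (param ψ x) (extChartAt (𝓡 n) x x)) = 0 := by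
  have h : IsNormalField ψ ν ↔
      ∀ (x : M) (v : EuclideanSpace ℝ (Fin n)), lorentz (ν x) (chartDeriv ψ x v) = 0 :=
    forall_congr' fun x => by rw [mfderiv_eq_chartDeriv (hψ x)]; rfl
  rw [h]
  exact ⟨fun h x i => h x _, fun h x v => lorentz_fderiv_of_normal (h x) v⟩

theorem isParallel_iff : IsParallel ψ ν ↔
    IsNormalField ψ ν ∧ MDifferentiable (𝓡 n) 𝓘(ℝ, Spacetime n) ν ∧
      ∀ (x : M) (v : EuclideanSpace ℝ (Fin n)), normalPart ψ x (chartDeriv ν x v) = 0 := by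
  refine and_congr_right fun _ => and_congr_right fun hν => forall_congr' fun x => ?_
  unfold normalDeriv
  rw [mfderiv_eq_chartDeriv (hν x)]
  rfl

theorem lorentz_chartDeriv_of_normalPart_eq_zero {u : Spacetime n} {x : M}
    (hu : ∀ i, lorentz u (partialDeriv i (param ψ x) (extChartAt (𝓡 n) x x)) = 0)
    {w : Spacetime n} (h : normalPart ψ x w = 0) : lorentz w u = 0 := by
  rw [← lorentz_normalPartCoord_of_normal hu]
  change lorentz (normalPart ψ x w) u = 0
  rw [h, lorentz_zero_left]

theorem chartDeriv_linear_comb {μ : M → Spacetime n} {x : M}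
    (hν : MDifferentiableAt (𝓡 n) 𝓘(ℝ, Spacetime n) ν x)
    (hμ : MDifferentiableAt (𝓡 n) 𝓘(ℝ, Spacetime n) μ x) (a b : ℝ)
    (v : EuclideanSpace ℝ (Fin n)) : chartDeriv (fun y => a • ν y + b • μ y) x v =
      a • chartDeriv ν x v + b • chartDeriv μ x v := by
  have h := ((hasFDerivAt_chartDeriv hν).const_smul a).add
    ((hasFDerivAt_chartDeriv hμ).const_smul b)
  exact congrArg (fun L => L v) h.fderiv

theorem IsParallel.linear_comb {μ : M → Spacetime n}
    (hψ : MDifferentiable (𝓡 n) 𝓘(ℝ, Spacetime n) ψ) (hν : IsParallel ψ ν)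
    (hμ : IsParallel ψ μ) (a b : ℝ) : IsParallel ψ (fun x => a • ν x + b • μ x) := by
  rw [isParallel_iff, isNormalField_iff hψ] at *
  refine ⟨fun x i => ?_, fun x => ?_, fun x v => ?_⟩
  · rw [lorentz_add_left, lorentz_smul_left, lorentz_smul_left, hν.1, hμ.1, mul_zero, mul_zero,
      add_zero]
  · exact (((a • ContinuousLinearMap.id ℝ (Spacetime n)).differentiable.differentiableAt
      ).mdifferentiableAt.comp x (hν.2.1 x)).add
      (((b • ContinuousLinearMap.id ℝ (Spacetime n)).differentiable.differentiableAt
      ).mdifferentiableAt.comp x (hμ.2.1 x))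
  · rw [chartDeriv_linear_comb (hν.2.1 x) (hμ.2.1 x), normalPart, normalPartCoord_eq, map_add,
      map_smul, map_smul]
    change a • normalPart ψ x _ + b • normalPart ψ x _ = 0
    rw [hν.2.2, hμ.2.2]; simp

theorem isNormalField_meanCurvature (hψ : ContMDiff (𝓡 n) 𝓘(ℝ, Spacetime n) ∞ ψ)
    (hs : IsSpacelike ψ) : IsNormalField ψ (meanCurvature ψ) := by
  rw [isNormalField_iff (hψ.mdifferentiable (by simp))]
  exact fun x i => lorentz_meanCurvatureCoord_partialDeriv
    (isUnit_det_gram_param (hψ.mdifferentiable (by simp)) hs x) i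

variable [IsManifold (𝓡 n) ∞ M]

theorem contDiffAt_param (hψ : ContMDiff (𝓡 n) 𝓘(ℝ, Spacetime n) ∞ ψ) {x : M}
    {q : EuclideanSpace ℝ (Fin n)} (hq : q ∈ (extChartAt (𝓡 n) x).target) :
    ContDiffAt ℝ ∞ (param ψ x) q := by
  rw [← contMDiffAt_iff_contDiffAt]
  exact hψ.contMDiffAt.comp q (((contMDiffOn_extChartAt_symm (n := ∞) x) q hq).contMDiffAt
    ((isOpen_extChartAt_target x).mem_nhds hq))

theorem eventually_contDiffAt_param (hψ : ContMDiff (𝓡 n) 𝓘(ℝ, Spacetime n) ∞ ψ) (x : M) :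
    ∀ᶠ q in nhds (extChartAt (𝓡 n) x x), ContDiffAt ℝ ∞ (param ψ x) q := by
  filter_upwards [(isOpen_extChartAt_target (I := 𝓡 n) x).mem_nhds (mem_extChartAt_target x)]
    with q hq using contDiffAt_param hψ hq

theorem isConePoint_param (hψ : ContMDiff (𝓡 n) 𝓘(ℝ, Spacetime n) ∞ ψ)
    (hc : ∀ x, ψ x ∈ futureCone n) {x : M} {q : EuclideanSpace ℝ (Fin n)}
    (hq : q ∈ (extChartAt (𝓡 n) x).target) (hu : IsUnit (gram (param ψ x) q).det) :
    IsConePoint (param ψ x) q where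
  isUnit_det := hu
  normal := lorentz_partialDeriv_of_null ((contDiffAt_param hψ hq).differentiableAt (by simp))
    (Filter.Eventually.of_forall fun _ => (hc _).1)
  null := (hc _).1
  pos := (hc _).2

theorem isConePoint_param_self (hψ : ContMDiff (𝓡 n) 𝓘(ℝ, Spacetime n) ∞ ψ)
    (hs : IsSpacelike ψ) (hc : ∀ x, ψ x ∈ futureCone n) (x : M) :
    IsConePoint (param ψ x) (extChartAt (𝓡 n) x x) :=
  isConePoint_param hψ hc (mem_extChartAt_target x)
    (isUnit_det_gram_param (hψ.mdifferentiable (by simp)) hs x)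

/-- The null normal field `η` with `⟨ψ, η⟩ = -1`. -/
def nullNormal (ψ : M → Spacetime n) (x : M) : Spacetime n :=
  nullNormalCoord (param ψ x) (extChartAt (𝓡 n) x x)

theorem lorentz_nullNormal_self (hψ : ContMDiff (𝓡 n) 𝓘(ℝ, Spacetime n) ∞ ψ)
    (hs : IsSpacelike ψ) (hc : ∀ x, ψ x ∈ futureCone n) (x : M) :
    lorentz (nullNormal ψ x) (nullNormal ψ x) = 0 :=
  have hp := isConePoint_param_self hψ hs hc x
  lorentz_nullNormalCoord_self hp.normal hp.null hp.pos

theorem lorentz_self_nullNormal (hψ : ContMDiff (𝓡 n) 𝓘(ℝ, Spacetime n) ∞ ψ)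
    (hs : IsSpacelike ψ) (hc : ∀ x, ψ x ∈ futureCone n) (x : M) :
    lorentz (ψ x) (nullNormal ψ x) = -1 := by
  have hp := isConePoint_param_self hψ hs hc x
  have := lorentz_self_nullNormalCoord hp.normal hp.null hp.pos
  rwa [param_self] at this

theorem isNormalField_nullNormal (hψ : ContMDiff (𝓡 n) 𝓘(ℝ, Spacetime n) ∞ ψ)
    (hs : IsSpacelike ψ) (hc : ∀ x, ψ x ∈ futureCone n) : IsNormalField ψ (nullNormal ψ) := by
  rw [isNormalField_iff (hψ.mdifferentiable (by simp))]
  intro x i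
  have hp := isConePoint_param_self hψ hs hc x
  exact lorentz_nullNormalCoord_partialDeriv hp.isUnit_det hp.normal i

theorem isNormalField_self (hψ : ContMDiff (𝓡 n) 𝓘(ℝ, Spacetime n) ∞ ψ)
    (hs : IsSpacelike ψ) (hc : ∀ x, ψ x ∈ futureCone n) : IsNormalField ψ ψ := by
  rw [isNormalField_iff (hψ.mdifferentiable (by simp))]
  intro x i
  have := (isConePoint_param_self hψ hs hc x).normal i
  rwa [param_self] at this

theorem normal_eq (hψ : ContMDiff (𝓡 n) 𝓘(ℝ, Spacetime n) ∞ ψ)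
    (hs : IsSpacelike ψ) (hc : ∀ x, ψ x ∈ futureCone n) {x : M} {u : Spacetime n}
    (hu : ∀ i, lorentz u (partialDeriv i (param ψ x) (extChartAt (𝓡 n) x x)) = 0) :
    u = (-lorentz u (ψ x)) • nullNormal ψ x + (-lorentz u (nullNormal ψ x)) • ψ x := by
  have hm := hψ.mdifferentiable (by simp)
  exact normal_eq_of_lorentz (isUnit_det_gram_param hm hs x)
    ((isNormalField_iff hm).1 (isNormalField_self hψ hs hc) x)
    ((isNormalField_iff hm).1 (isNormalField_nullNormal hψ hs hc) x) (hc x).1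
    (lorentz_nullNormal_self hψ hs hc x) (lorentz_self_nullNormal hψ hs hc x) hu

/-- In the null frame `u = η - ⟨u, η⟩ ψ`, so `0 = ⟨u, u⟩ = 2 ⟨u, η⟩`. As `nullNormal` uses a
different chart at each point, uniqueness is what makes it independent of the chart. -/
theorem nullNormal_unique (hψ : ContMDiff (𝓡 n) 𝓘(ℝ, Spacetime n) ∞ ψ)
    (hs : IsSpacelike ψ) (hc : ∀ x, ψ x ∈ futureCone n) {x : M} {u : Spacetime n}
    (hu : ∀ i, lorentz u (partialDeriv i (param ψ x) (extChartAt (𝓡 n) x x)) = 0)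
    (h1 : lorentz (ψ x) u = -1) (h0 : lorentz u u = 0) : u = nullNormal ψ x := by
  have h := normal_eq hψ hs hc hu
  rw [lorentz_comm u (ψ x), h1, neg_neg, one_smul] at h
  have h2 : lorentz u u = lorentz u (nullNormal ψ x + (-lorentz u (nullNormal ψ x)) • ψ x) :=
    congrArg _ h
  rw [lorentz_add_right, lorentz_smul_right, lorentz_comm u (ψ x), h1, h0] at h2
  have h3 : lorentz u (nullNormal ψ x) = 0 := by linarith
  rwa [h3, neg_zero, zero_smul, add_zero] at h

/-- Two charts give the same tangent space; `w` is the image of `v` under the change of coordinates.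
Its value is irrelevant for testing normality. -/
theorem chartDeriv_eq_fderiv_param (hψ : ContMDiff (𝓡 n) 𝓘(ℝ, Spacetime n) ∞ ψ) {x y : M}
    (hy : y ∈ (extChartAt (𝓡 n) x).source) (v : EuclideanSpace ℝ (Fin n)) :
    ∃ w, chartDeriv ψ y v =
      fderiv ℝ (param ψ x) (extChartAt (𝓡 n) x y) w := by
  have he : MDifferentiableAt (𝓡 n) 𝓘(ℝ, EuclideanSpace ℝ (Fin n)) (extChartAt (𝓡 n) x) y :=
    (contMDiffAt_extChartAt' (n := ∞) (by simpa using hy)).mdifferentiableAt (by simp)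
  have hd : MDifferentiableAt 𝓘(ℝ, EuclideanSpace ℝ (Fin n)) 𝓘(ℝ, Spacetime n) (param ψ x)
      (extChartAt (𝓡 n) x y) :=
    ((contDiffAt_param hψ ((extChartAt (𝓡 n) x).map_source hy)).differentiableAt
      (by simp)).mdifferentiableAt
  have heq : ψ =ᶠ[nhds y] param ψ x ∘ extChartAt (𝓡 n) x := by
    filter_upwards [(isOpen_extChartAt_source (I := 𝓡 n) x).mem_nhds hy] with z hz
    exact (param_extChartAt hz).symm
  refine ⟨mfderiv (𝓡 n) 𝓘(ℝ, EuclideanSpace ℝ (Fin n)) (extChartAt (𝓡 n) x) y v, ?_⟩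
  have h1 := mfderiv_comp y hd he
  rw [← heq.mfderiv_eq, mfderiv_eq_chartDeriv (hψ.mdifferentiable (by simp) y),
    mfderiv_eq_fderiv] at h1
  exact congrArg (fun L => L v) h1

/-- Near `x` the field agrees with one built in a single chart, from which it inherits
differentiability. -/
theorem eventually_nullNormal_eq (hψ : ContMDiff (𝓡 n) 𝓘(ℝ, Spacetime n) ∞ ψ)
    (hs : IsSpacelike ψ) (hc : ∀ x, ψ x ∈ futureCone n) (x : M) :
    nullNormal ψ =ᶠ[nhds x] nullNormalCoord (param ψ x) ∘ extChartAt (𝓡 n) x := by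
  have hm := hψ.mdifferentiable (by simp)
  filter_upwards [extChartAt_source_mem_nhds (I := 𝓡 n) x,
    (continuousAt_extChartAt (I := 𝓡 n) x).eventually (eventually_isUnit_det_gram
      (eventually_contDiffAt_param hψ x).self_of_nhds (isUnit_det_gram_param hm hs x))] with y hy hu
  have hp := isConePoint_param hψ hc ((extChartAt (𝓡 n) x).map_source hy) hu
  refine (nullNormal_unique hψ hs hc (fun i => ?_) ?_ ?_).symm
  · rw [partialDeriv_param]
    obtain ⟨w, hw⟩ := chartDeriv_eq_fderiv_param hψ hy (coordVec i)
    rw [hw]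
    exact lorentz_fderiv_of_normal (lorentz_nullNormalCoord_partialDeriv hp.isUnit_det hp.normal) w
  · have := lorentz_self_nullNormalCoord hp.normal hp.null hp.pos
    rwa [param_extChartAt hy] at this
  · exact lorentz_nullNormalCoord_self hp.normal hp.null hp.pos

theorem mdifferentiable_nullNormal (hψ : ContMDiff (𝓡 n) 𝓘(ℝ, Spacetime n) ∞ ψ)
    (hs : IsSpacelike ψ) (hc : ∀ x, ψ x ∈ futureCone n) :
    MDifferentiable (𝓡 n) 𝓘(ℝ, Spacetime n) (nullNormal ψ) := by
  intro x
  have hp := isConePoint_param_self hψ hs hc x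
  refine MDifferentiableAt.congr_of_eventuallyEq ?_ (eventually_nullNormal_eq hψ hs hc x)
  exact MDifferentiableAt.comp x (((contDiffAt_nullNormalCoord
    (eventually_contDiffAt_param hψ x).self_of_nhds hp.isUnit_det hp.pos).differentiableAt
      (by simp)).mdifferentiableAt)
    ((contMDiffAt_extChartAt (n := ∞)).mdifferentiableAt (by simp))

/-- The inner product of two parallel normal fields is constant. -/
theorem IsParallel.isConst_lorentz [PreconnectedSpace M] [Nonempty M]
    (hψ : MDifferentiable (𝓡 n) 𝓘(ℝ, Spacetime n) ψ) {μ : M → Spacetime n}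
    (hν : IsParallel ψ ν) (hμ : IsParallel ψ μ) : IsConst fun x => lorentz (ν x) (μ x) := by
  rw [isParallel_iff, isNormalField_iff hψ] at hν hμ
  refine isConst_of_chartDeriv_eq_zero (fun x => mdifferentiableAt_lorentz (hν.2.1 x) (hμ.2.1 x))
    fun x v => ?_
  rw [chartDeriv_lorentz (hν.2.1 x) (hμ.2.1 x), lorentz_comm (ν x),
    lorentz_chartDeriv_of_normalPart_eq_zero (hμ.1 x) (hν.2.2 x v),
    lorentz_chartDeriv_of_normalPart_eq_zero (hν.1 x) (hμ.2.2 x v), add_zero]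

theorem isParallel_self (hψ : ContMDiff (𝓡 n) 𝓘(ℝ, Spacetime n) ∞ ψ)
    (hs : IsSpacelike ψ) (hc : ∀ x, ψ x ∈ futureCone n) : IsParallel ψ ψ := by
  have hm := hψ.mdifferentiable (by simp)
  exact isParallel_iff.2 ⟨isNormalField_self hψ hs hc, hm, fun x v =>
    normalPartCoord_fderiv (isUnit_det_gram_param hm hs x) v⟩

/-- The normal part of `dη` pairs to zero with `η`, because `⟨η, η⟩` is constant, and with `ψ`,
because `⟨dη, ψ⟩ = -⟨η, dψ⟩ = 0`. Both its components in the null frame vanish. -/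
theorem isParallel_nullNormal (hψ : ContMDiff (𝓡 n) 𝓘(ℝ, Spacetime n) ∞ ψ)
    (hs : IsSpacelike ψ) (hc : ∀ x, ψ x ∈ futureCone n) : IsParallel ψ (nullNormal ψ) := by
  have hm := hψ.mdifferentiable (by simp)
  have hη := mdifferentiable_nullNormal hψ hs hc
  have hηn := isNormalField_nullNormal hψ hs hc
  refine isParallel_iff.2 ⟨hηn, hη, fun x v => ?_⟩
  rw [isNormalField_iff hm] at hηn
  have zero_of_const (f : M → ℝ) (c : ℝ) (h : ∀ y, f y = c) : chartDeriv f x v = 0 := by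
    obtain rfl : f = fun _ => c := funext h
    change fderiv ℝ (fun _ => c) _ v = 0
    simp
  have h1 := zero_of_const _ _ (lorentz_nullNormal_self hψ hs hc)
  have h2 := zero_of_const _ _ (lorentz_self_nullNormal hψ hs hc)
  rw [chartDeriv_lorentz (hη x) (hη x), lorentz_comm (nullNormal ψ x)] at h1
  rw [chartDeriv_lorentz (hm x) (hη x), lorentz_comm _ (nullNormal ψ x),
    show lorentz (nullNormal ψ x) (chartDeriv ψ x v) = 0 from
      lorentz_fderiv_of_normal (hηn x) v, zero_add, lorentz_comm] at h2
  have hu := lorentz_normalPartCoord_partialDeriv (isUnit_det_gram_param hm hs x)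
    (chartDeriv (nullNormal ψ) x v)
  have h := normal_eq hψ hs hc hu
  rw [lorentz_normalPartCoord_of_normal (hηn x), lorentz_normalPartCoord_of_normal
      ((isNormalField_iff hm).1 (isNormalField_self hψ hs hc) x), h2,
    show lorentz (chartDeriv (nullNormal ψ) x v) (nullNormal ψ x) = 0 by linarith] at h
  simpa [normalPart] using h

theorem lorentz_meanCurvature_self (hn : n ≠ 0) (hψ : ContMDiff (𝓡 n) 𝓘(ℝ, Spacetime n) ∞ ψ)
    (hs : IsSpacelike ψ) (hc : ∀ x, ψ x ∈ futureCone n) (x : M) :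
    lorentz (meanCurvature ψ x) (ψ x) = -1 := by
  have := lorentz_meanCurvatureCoord_self hn
    (isUnit_det_gram_param (hψ.mdifferentiable (by simp)) hs x)
    (lorentz_secondFormCoord_of_null (eventually_contDiffAt_param hψ x)
      (Filter.Eventually.of_forall fun _ => (hc _).1))
  rwa [param_self] at this

/-- Since `⟨H, ψ⟩ = -1`, the `η`-component is `1`; squaring then gives `⟨H, H⟩ = 2 ⟨H, η⟩`, which
fixes the `ψ`-component. -/
theorem meanCurvature_eq (hn : n ≠ 0) (hψ : ContMDiff (𝓡 n) 𝓘(ℝ, Spacetime n) ∞ ψ)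
    (hs : IsSpacelike ψ) (hc : ∀ x, ψ x ∈ futureCone n) (x : M) :
    meanCurvature ψ x = nullNormal ψ x +
      (-lorentz (meanCurvature ψ x) (meanCurvature ψ x) / 2) • ψ x := by
  have h := normal_eq hψ hs hc ((isNormalField_iff (hψ.mdifferentiable (by simp))).1
    (isNormalField_meanCurvature hψ hs) x)
  have h1 := lorentz_meanCurvature_self hn hψ hs hc x
  rw [h1, neg_neg, one_smul] at h
  have h2 : lorentz (meanCurvature ψ x) (meanCurvature ψ x) =
      lorentz (meanCurvature ψ x) (nullNormal ψ x +
        (-lorentz (meanCurvature ψ x) (nullNormal ψ x)) • ψ x) := congrArg _ h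
  rw [lorentz_add_right, lorentz_smul_right, h1] at h2
  rw [h2]
  conv_lhs => rw [h]
  congr 2
  ring

theorem secondFormSq_eq (hn : n ≠ 0) (hψ : ContMDiff (𝓡 n) 𝓘(ℝ, Spacetime n) ∞ ψ)
    (hs : IsSpacelike ψ) (hc : ∀ x, ψ x ∈ futureCone n) (x : M) :
    secondFormSq ψ x = n * lorentz (meanCurvature ψ x) (meanCurvature ψ x) :=
  secondFormSqCoord_eq hn (isConePoint_param_self hψ hs hc x)
    (lorentz_secondFormCoord_of_null (eventually_contDiffAt_param hψ x)
      (Filter.Eventually.of_forall fun _ => (hc _).1))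

theorem scalarCurvature_eq (hn : n ≠ 0) (hψ : ContMDiff (𝓡 n) 𝓘(ℝ, Spacetime n) ∞ ψ)
    (hs : IsSpacelike ψ) (hc : ∀ x, ψ x ∈ futureCone n) (x : M) :
    scalarCurvature ψ x = n * (n - 1) * lorentz (meanCurvature ψ x) (meanCurvature ψ x) := by
  have h1 := scalarCurvatureCoord_gram hn (eventually_contDiffAt_param hψ x)
    (isUnit_det_gram_param (hψ.mdifferentiable (by simp)) hs x)
  have h2 := secondFormSq_eq hn hψ hs hc x
  unfold secondFormSq at h2
  rw [h2] at h1
  rw [scalarCurvature, h1, meanCurvature]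
  ring

/-- If `⟨H, H⟩ = c`, then `H = η - (c / 2) ψ` has constant coefficients in the parallel frame; this
also supplies the differentiability of `H`. -/
theorem isParallel_meanCurvature_iff [PreconnectedSpace M] [Nonempty M] (hn : n ≠ 0)
    (hψ : ContMDiff (𝓡 n) 𝓘(ℝ, Spacetime n) ∞ ψ)
    (hs : IsSpacelike ψ) (hc : ∀ x, ψ x ∈ futureCone n) :
    IsParallel ψ (meanCurvature ψ) ↔
      IsConst fun x => lorentz (meanCurvature ψ x) (meanCurvature ψ x) := by
  refine ⟨fun h => h.isConst_lorentz (hψ.mdifferentiable (by simp)) h, ?_⟩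
  rintro ⟨c, hcst⟩
  replace hcst : ∀ x, lorentz (meanCurvature ψ x) (meanCurvature ψ x) = c := hcst
  have h := (isParallel_nullNormal hψ hs hc).linear_comb (hψ.mdifferentiable (by simp))
    (isParallel_self hψ hs hc) 1 (-c / 2)
  convert h using 1
  funext x
  rw [meanCurvature_eq hn hψ hs hc x, hcst x, one_smul]

theorem isParallel_normalizedMeanCurvature_iff [PreconnectedSpace M] [Nonempty M] (hn : n ≠ 0)
    (hψ : ContMDiff (𝓡 n) 𝓘(ℝ, Spacetime n) ∞ ψ)
    (hs : IsSpacelike ψ) (hc : ∀ x, ψ x ∈ futureCone n)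
    (h0 : ∀ x, lorentz (meanCurvature ψ x) (meanCurvature ψ x) ≠ 0) :
    IsParallel ψ (normalizedMeanCurvature ψ) ↔ IsParallel ψ (meanCurvature ψ) := by
  constructor
  · intro h
    have hm := hψ.mdifferentiable (by simp)
    obtain ⟨a, ha⟩ := h.isConst_lorentz hm (isParallel_self hψ hs hc)
    obtain ⟨b, hb⟩ := h.isConst_lorentz hm h
    rw [isParallel_meanCurvature_iff hn hψ hs hc]
    -- Here `a = -1 / √|⟨H, H⟩|` because `⟨H, ψ⟩ = -1`, and `b = ⟨H, H⟩ / |⟨H, H⟩|` carries the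
    -- sign.
    refine ⟨b / a ^ 2, fun x => ?_⟩
    have h1 := ha x
    have h2 := hb x
    have hsq : Real.sqrt |lorentz (meanCurvature ψ x) (meanCurvature ψ x)| ≠ 0 :=
      (Real.sqrt_pos.2 (abs_pos.2 (h0 x))).ne'
    simp only [normalizedMeanCurvature, lorentz_smul_left, lorentz_smul_right,
      lorentz_meanCurvature_self hn hψ hs hc] at h1 h2
    rw [← h1, ← h2]
    field_simp
  · intro h
    obtain ⟨c, hcst⟩ := (isParallel_meanCurvature_iff hn hψ hs hc).1 h
    replace hcst : ∀ x, lorentz (meanCurvature ψ x) (meanCurvature ψ x) = c := hcst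
    have := h.linear_comb (hψ.mdifferentiable (by simp)) h (1 / Real.sqrt |c|) 0
    convert this using 1
    funext x
    rw [normalizedMeanCurvature, hcst x, zero_smul, add_zero]

end ConeSubmanifold

end LightCone

end

/-! ### The equivalences -/

theorem mainTheorem11 {n : ℕ} (hn : 2 ≤ n) {M : Type*} [TopologicalSpace M] [ConnectedSpace M]
    [ChartedSpace (EuclideanSpace ℝ (Fin n)) M] [IsManifold (𝓡 n) ∞ M]
    (ψ : M → LightCone.Spacetime n)
    (hψ : ContMDiff (𝓡 n) 𝓘(ℝ, LightCone.Spacetime n) ∞ ψ)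
    (hspacelike : LightCone.IsSpacelike ψ)
    (hcone : ∀ x, ψ x ∈ LightCone.futureCone n) :
    List.TFAE
      [LightCone.IsParallel ψ (LightCone.meanCurvature ψ),
        LightCone.IsConst fun x =>
          LightCone.lorentz (LightCone.meanCurvature ψ x) (LightCone.meanCurvature ψ x),
        LightCone.IsConst (LightCone.scalarCurvature ψ),
        LightCone.IsConst (LightCone.secondFormSq ψ)] ∧
    ((∀ x, LightCone.lorentz (LightCone.meanCurvature ψ x) (LightCone.meanCurvature ψ x) ≠ 0) →
      List.TFAE
        [LightCone.IsParallel ψ (LightCone.meanCurvature ψ),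
          LightCone.IsConst fun x =>
            LightCone.lorentz (LightCone.meanCurvature ψ x) (LightCone.meanCurvature ψ x),
          LightCone.IsConst (LightCone.scalarCurvature ψ),
          LightCone.IsConst (LightCone.secondFormSq ψ),
          LightCone.IsParallel ψ (LightCone.normalizedMeanCurvature ψ)]) := by
  have hn0 : n ≠ 0 := by omega
  have hnR : (n : ℝ) ≠ 0 := by exact_mod_cast hn0
  -- This is where `n ≥ 2` enters: for `n = 1` the factor `n (n - 1)` vanishes and the scalar
  -- curvature carries no information.
  have hn1 : (n : ℝ) - 1 ≠ 0 := by
    have : (2 : ℝ) ≤ n := by exact_mod_cast hn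
    linarith
  have h12 := LightCone.isParallel_meanCurvature_iff hn0 hψ hspacelike hcone
  have h32 := LightCone.isConst_const_mul_iff (mul_ne_zero hnR hn1)
    (LightCone.scalarCurvature_eq hn0 hψ hspacelike hcone)
  have h42 := LightCone.isConst_const_mul_iff hnR
    (LightCone.secondFormSq_eq hn0 hψ hspacelike hcone)
  refine ⟨?_, fun h0 => ?_⟩
  · tfae_have 1 ↔ 2 := h12
    tfae_have 3 ↔ 2 := h32
    tfae_have 4 ↔ 2 := h42
    tfae_finish
  · have h51 := LightCone.isParallel_normalizedMeanCurvature_iff hn0 hψ hspacelike hcone h0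
    tfae_have 1 ↔ 2 := h12
    tfae_have 3 ↔ 2 := h32
    tfae_have 4 ↔ 2 := h42
    tfae_have 5 ↔ 1 := h51
    tfae_finish
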